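/- Define non-negative integers $a_{n,l}$ ($n,l\ge 0$) by $a_{0,0}=1$, $a_{n,0}=0$ for $n>0$, and $$a_{n,l}=\sum_{i=l-1}^{n-1}a_{i,l-1}\binom{2n+l-1}{2n-2i}\qquad(l\ge 1),$$ and define the values $P^{(j)}(n)$, $1\le j\le n$, of the P-polynomials by $$a_{n,l}=\frac{(2n)!}{6^n}\,l\,\binom{2n+l}{2n}\,P^{(n+1-l)}(n)\qquad(1\le l\le n)$$ (so that $P^{(1)}(n)=\frac1n$, $P^{(2)}(n)=\frac3{10}$, $P^{(3)}(n)=\frac{3(21n-43)}{1400}$, and so on). For $r\in\{6,8\}$ and $l\ge 1$ put $$c^{[r]}_l=\sum_{n=1}^{\infty}\frac{n(n+1)\,P^{(l)}(n+l-1)}{\prod_{i=0}^{r-1}(2n+2l-3+i)}\left(\frac{\pi}{6\sqrt6}\right)^{2n}.$$ For $r\in\{6,8\}$, all the series $c^{[r]}_l$ ($l\ge1$) and the series $\sum_{l\ge 1}(-1)^{l+1}c^{[r]}_l\left(\frac{\pi}{6\sqrt6}\right)^{2l}$ converge absolutely, and $$\zeta(5)=\frac{3\pi^2}{29}\zeta(3)-\frac{25\pi^4}{12528}+\frac{\pi^4}{1044}\ln\left(\frac{\pi}{3}\right)-\frac{144\pi^2}{29}\sum_{l=1}^{\infty}(-1)^{l+1}c^{[6]}_l\left(\frac{\pi}{6\sqrt6}\right)^{2l},$$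 $$\zeta(7)=\frac{72\pi^2}{659}\zeta(5)-\frac{2\pi^4}{1977}\zeta(3)+\frac{49\pi^6}{5337900}-\frac{\pi^6}{266895}\ln\left(\frac{\pi}{3}\right)+\frac{3456\pi^4}{5931}\sum_{l=1}^{\infty}(-1)^{l+1}c^{[8]}_l\left(\frac{\pi}{6\sqrt6}\right)^{2l}.$$ -/

import Mathlib

namespace OddZeta

/-- Riordan's coefficients `a_{n,l}` of the central factorial numbers, given by the recursion
`a_{0,0} = 1`, `a_{n,0} = 0` for `n > 0`, and
`a_{n,l} = ∑_{i=l-1}^{n-1} a_{i,l-1} * binom(2n+l-1, 2n-2i)` for `l ≥ 1`. -/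
def riordanCoeff : ℕ → ℕ → ℕ
  | n, 0 => if n = 0 then 1 else 0
  | n, l + 1 => ∑ i ∈ Finset.Ico l n, riordanCoeff i l * (2 * n + l).choose (2 * n - 2 * i)

/-- The value `P^{(j)}(n)` of the `j`-th P-polynomial, for `1 ≤ j ≤ n`. It is the solution of
`a_{n,l} = ((2n)! / 6^n) * l * binom(2n+l, 2n) * P^{(n+1-l)}(n)` with `l = n + 1 - j`. -/
noncomputable def bernoulliP (j n : ℕ) : ℝ :=
  6 ^ n * (riordanCoeff n (n + 1 - j) : ℝ) /
    (((2 * n).factorial : ℝ) * ((n + 1 - j : ℕ) : ℝ) *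
      ((2 * n + (n + 1 - j)).choose (2 * n) : ℝ))

/-- The number `π / (6 √6)`. -/
noncomputable def baseX : ℝ := Real.pi / (6 * √6)

/-- The `n`-th term (`n ≥ 1`) of the series for the coefficient `c_l` (`l ≥ 1`) whose denominator
is the product of the `r` consecutive integers starting with `2(n+l-1) - 1 = 2n + 2l - 3`. -/
noncomputable def coeffTerm (r l n : ℕ) : ℝ :=
  (n : ℝ) * ((n : ℝ) + 1) * bernoulliP l (n + l - 1) /
    (∏ i ∈ Finset.range r, (2 * (n : ℝ) + 2 * (l : ℝ) - 3 + (i : ℝ))) * baseX ^ (2 * n)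

/-- The coefficient `c_l = ∑_{n ≥ 1} coeffTerm r l n`. -/
noncomputable def coeffC (r l : ℕ) : ℝ := ∑' n : ℕ, coeffTerm r l (n + 1)

/-- The `l`-th term (`l ≥ 1`) of the outer alternating series, `(-1)^{l+1} c_l (π/(6√6))^{2l}`. -/
noncomputable def outerTerm (r l : ℕ) : ℝ := (-1) ^ (l + 1) * coeffC r l * baseX ^ (2 * l)

end OddZeta

namespace OddZeta

/-! Put `S(u) = ∑_{k≥1} u^k/(2k+1)!`, so that `S(x²) = sinh x / x - 1` and `S(-x²) = sin x / x - 1`.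
The recursion says that `(sinh x - x)^l / l!` is the exponential generating function of the
`a_{n,l}` (`riordanCoeff_mul_factorial`), so the P-values are rescaled coefficients of powers of
`S`. With `t = 1 - sin x / x`, the expansion `1/(1-t)² - 1 = ∑ (n+2) t^(n+1)` gives a double series
for `1/sin² x - 1/x²`. It converges absolutely for `|x| ≤ 1` because `sinh 1 - 1 < 1`. Integrating
it `r` times from `0` produces the product of `r` consecutive integers in the denominator, and at `x
= π/6` it becomes the outer series up to an explicit factor (`hasSum_outerTerm`). The same
antiderivatives have closed forms: `log (x / sin x)` at order 2, then powers of `x` times logarithms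
plus the sums `∑ sin(2kx)/k^s` and `∑ cos(2kx)/k^s`, where odd zeta values enter as integration
constants. At `π/6` the cosine sums are rational multiples of `ζ(s)` (`clausenCos_pi_div_six`);
orders 6 and 8 are then solved for `ζ(5)` and `ζ(7)`. -/

open Filter Topology

/-! ### Riordan's coefficients as coefficients of powers of `sinh x / x - 1`. -/

/-- The power series `∑_{k ≥ 1} u^k / (2k+1)!`, which is `sinh x / x - 1` at `u = x²` and
`sin x / x - 1` at `u = -x²`. -/
noncomputable def sinhcSeries : PowerSeries ℝ :=
  PowerSeries.mk fun k => if k = 0 then 0 else 1 / ((2 * k + 1).factorial : ℝ)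

/-- The power series `∑_{k ≥ 1} u^k / (2k)!`. -/
noncomputable def coshSubOneSeries : PowerSeries ℝ :=
  PowerSeries.mk fun k => if k = 0 then 0 else 1 / ((2 * k).factorial : ℝ)

/-- This is `d/dx (sinh x - x) = cosh x - 1` in the variable `u = x²`. -/
theorem sinhcSeries_add_derivative :
    sinhcSeries + 2 * (PowerSeries.X * PowerSeries.derivative ℝ sinhcSeries)
      = coshSubOneSeries := by
  ext k
  rw [show (2 : PowerSeries ℝ) = PowerSeries.C (2 : ℝ) from (map_ofNat PowerSeries.C 2).symm, map_add,
    PowerSeries.coeff_C_mul]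
  rcases k with _ | k
  · simp [sinhcSeries, coshSubOneSeries]
  · rw [PowerSeries.coeff_succ_X_mul, PowerSeries.coeff_derivative]
    simp only [sinhcSeries, coshSubOneSeries, PowerSeries.coeff_mk, Nat.succ_ne_zero, if_false]
    rw [Nat.factorial_succ (2 * (k + 1))]
    push_cast
    field_simp
    ring

/-- Coefficientwise form of differentiating `(sinh x - x)^(l+1)` in `x`. -/
theorem coeff_sinhcSeries_pow_succ (l N : ℕ) :
    (l + 1 + 2 * N : ℝ) * PowerSeries.coeff N (sinhcSeries ^ (l + 1)) =
      (l + 1) * PowerSeries.coeff N (sinhcSeries ^ l * coshSubOneSeries) := by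
  have h : PowerSeries.C (l + 1 : ℝ) * sinhcSeries ^ (l + 1)
      + PowerSeries.C 2 * (PowerSeries.X * PowerSeries.derivative ℝ (sinhcSeries ^ (l + 1)))
      = PowerSeries.C (l + 1 : ℝ) * (sinhcSeries ^ l * coshSubOneSeries) := by
    rw [← sinhcSeries_add_derivative, Derivation.leibniz_pow]
    simp only [map_add, map_natCast, map_one, map_ofNat, nsmul_eq_mul, smul_eq_mul,
      Nat.add_sub_cancel]
    push_cast
    ring
  have hX : PowerSeries.coeff N
      (PowerSeries.X * PowerSeries.derivative ℝ (sinhcSeries ^ (l + 1)))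
      = N * PowerSeries.coeff N (sinhcSeries ^ (l + 1)) := by
    rcases N with _ | N
    · simp
    · rw [PowerSeries.coeff_succ_X_mul, PowerSeries.coeff_derivative]
      push_cast
      ring
  have h2 := congrArg (PowerSeries.coeff N) h
  rw [map_add, PowerSeries.coeff_C_mul, PowerSeries.coeff_C_mul, PowerSeries.coeff_C_mul, hX] at h2
  linarith

theorem coeff_sinhcSeries_pow_of_lt {l N : ℕ} (h : N < l) :
    PowerSeries.coeff N (sinhcSeries ^ l) = 0 := by
  have h1 : PowerSeries.X ∣ sinhcSeries := by
    rw [PowerSeries.X_dvd_iff]; simp [sinhcSeries]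
  exact (PowerSeries.X_pow_dvd_iff.1 (pow_dvd_pow_of_dvd h1 l)) N h

/-- Once the binomial is split into factorials, the recursion is the Cauchy product of `S^l` with
`cosh - 1`, which the preceding derivative identity turns into `S^(l+1)`. -/
theorem riordanCoeff_mul_factorial (l N : ℕ) :
    (riordanCoeff N l : ℝ) * l.factorial =
      (2 * N + l).factorial * PowerSeries.coeff N (sinhcSeries ^ l) := by
  induction l generalizing N with
  | zero =>
    rw [riordanCoeff, pow_zero, PowerSeries.coeff_one]
    split_ifs with h <;> simp [h]
  | succ l ih =>
    have hsum : PowerSeries.coeff N (sinhcSeries ^ l * coshSubOneSeries) =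
        ∑ i ∈ Finset.Ico l N, PowerSeries.coeff i (sinhcSeries ^ l) /
          ((2 * N - 2 * i).factorial : ℝ) := by
      rw [PowerSeries.coeff_mul, Finset.Nat.sum_antidiagonal_eq_sum_range_succ_mk]
      symm
      have hs : Finset.Ico l N ⊆ Finset.range (N + 1) := by
        intro i hi
        simp at hi ⊢
        omega
      -- The extra indices contribute nothing: `S^l` has order at least `l`, and `cosh - 1` has no
      -- constant term, which kills `i = N`.
      refine (Finset.sum_congr rfl fun i hi => ?_).trans (Finset.sum_subset hs fun i hi hi' => ?_)
      · have hi' := Finset.mem_Ico.1 hi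
        simp only [coshSubOneSeries, PowerSeries.coeff_mk]
        rw [if_neg (by omega), Nat.mul_sub, mul_one_div]
      · simp only [Finset.mem_Ico, not_and, not_lt, Finset.mem_range] at hi hi'
        rcases lt_or_ge i l with h | h
        · simp [coeff_sinhcSeries_pow_of_lt h]
        · have : N - i = 0 := by have := hi' h; omega
          simp [coshSubOneSeries, this]
    have key := coeff_sinhcSeries_pow_succ l N
    rw [hsum] at key
    have hpos : (0 : ℝ) < l + 1 + 2 * N := by positivity
    rw [show (2 * N + (l + 1)) = (2 * N + l) + 1 by ring, Nat.factorial_succ (2 * N + l)]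
    have h3 : (riordanCoeff N (l + 1) : ℝ) * l.factorial = (2 * N + l).factorial *
        ∑ i ∈ Finset.Ico l N, PowerSeries.coeff i (sinhcSeries ^ l) /
          ((2 * N - 2 * i).factorial : ℝ) := by
      rw [riordanCoeff]
      push_cast
      rw [Finset.sum_mul, Finset.mul_sum]
      refine Finset.sum_congr rfl fun i hi => ?_
      have hi' := Finset.mem_Ico.1 hi
      rw [Nat.cast_choose ℝ (by omega : 2 * N - 2 * i ≤ 2 * N + l),
        show 2 * N + l - (2 * N - 2 * i) = 2 * i + l by omega]
      have := ih i
      have h4 : ((2 * i + l).factorial : ℝ) ≠ 0 := by positivity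
      field_simp
      linear_combination this
    rw [Nat.factorial_succ l]
    push_cast
    linear_combination (l + 1 : ℝ) * h3 - ((2 * N + l).factorial : ℝ) * key

theorem bernoulliP_eq_coeff (n l : ℕ) :
    bernoulliP (l + 1) (n + l + 1) =
      6 ^ (n + l + 1) / (n + 1) * PowerSeries.coeff (n + l + 1) (sinhcSeries ^ (n + 1)) := by
  have h := riordanCoeff_mul_factorial (n + 1) (n + l + 1)
  rw [bernoulliP, show n + l + 1 + 1 - (l + 1) = n + 1 by omega,
    Nat.cast_choose ℝ (by omega : 2 * (n + l + 1) ≤ 2 * (n + l + 1) + (n + 1)),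
    Nat.add_sub_cancel_left]
  have h1 : ((2 * (n + l + 1) + (n + 1)).factorial : ℝ) ≠ 0 := by positivity
  have h2 : ((2 * (n + l + 1)).factorial : ℝ) ≠ 0 := by positivity
  push_cast
  field_simp
  linear_combination h

/-- Inherited from the natural numbers `a_{n,l}`. It lets absolute values of the sine expansion be
summed as the hyperbolic sine expansion. -/
theorem coeff_sinhcSeries_pow_nonneg (l N : ℕ) :
    0 ≤ PowerSeries.coeff N (sinhcSeries ^ l) := by
  have h := riordanCoeff_mul_factorial l N
  have h1 : (0 : ℝ) < (2 * N + l).factorial := by positivity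
  have h2 : (0 : ℝ) ≤ (riordanCoeff N l : ℝ) * l.factorial := by positivity
  rw [h] at h2
  exact nonneg_of_mul_nonneg_right h2 h1

/-! ### Evaluation of powers of the series at `±x²`. -/

theorem hasSum_coeff_mul_of_norm {p q : PowerSeries ℝ} {u a b : ℝ}
    (hp : Summable fun k => ‖PowerSeries.coeff k p * u ^ k‖)
    (hq : Summable fun k => ‖PowerSeries.coeff k q * u ^ k‖)
    (ha : HasSum (fun k => PowerSeries.coeff k p * u ^ k) a)
    (hb : HasSum (fun k => PowerSeries.coeff k q * u ^ k) b) :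
    (Summable fun k => ‖PowerSeries.coeff k (p * q) * u ^ k‖) ∧
      HasSum (fun k => PowerSeries.coeff k (p * q) * u ^ k) (a * b) := by
  have h : ∀ k, PowerSeries.coeff k (p * q) * u ^ k =
      ∑ ij ∈ Finset.HasAntidiagonal.antidiagonal k, (PowerSeries.coeff ij.1 p * u ^ ij.1) *
        (PowerSeries.coeff ij.2 q * u ^ ij.2) := by
    intro k
    rw [PowerSeries.coeff_mul, Finset.sum_mul]
    refine Finset.sum_congr rfl fun ij hij => ?_
    rw [← Finset.HasAntidiagonal.mem_antidiagonal.1 hij, pow_add]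
    ring
  simp_rw [h]
  have hs := summable_norm_sum_mul_antidiagonal_of_summable_norm hp hq
  refine ⟨hs, ?_⟩
  rw [← ha.tsum_eq, ← hb.tsum_eq, tsum_mul_tsum_eq_tsum_sum_antidiagonal_of_summable_norm hp hq]
  exact hs.of_norm.hasSum

theorem hasSum_coeff_pow {p : PowerSeries ℝ} {u a : ℝ}
    (hp : Summable fun k => ‖PowerSeries.coeff k p * u ^ k‖)
    (ha : HasSum (fun k => PowerSeries.coeff k p * u ^ k) a) (n : ℕ) :
    (Summable fun k => ‖PowerSeries.coeff k (p ^ n) * u ^ k‖) ∧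
      HasSum (fun k => PowerSeries.coeff k (p ^ n) * u ^ k) (a ^ n) := by
  induction n with
  | zero =>
    have h : ∀ k, k ≠ 0 → PowerSeries.coeff k (1 : PowerSeries ℝ) * u ^ k = 0 := by
      intro k hk
      simp [PowerSeries.coeff_one, hk]
    constructor
    · simp only [pow_zero]
      exact summable_of_ne_finset_zero (s := {0}) fun k hk => by
        rw [h k (by simpa using hk), norm_zero]
    · simp only [pow_zero]
      simpa using hasSum_single 0 h
  | succ n ih =>
    rw [pow_succ, pow_succ]
    exact hasSum_coeff_mul_of_norm ih.1 hp ih.2 ha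

theorem hasSum_sinhcSeries {u v x : ℝ} (hx : x ≠ 0)
    (h : HasSum (fun k : ℕ => u ^ k * x / ((2 * k + 1).factorial : ℝ)) v) :
    HasSum (fun k => PowerSeries.coeff k sinhcSeries * u ^ k) (v / x - 1) := by
  have h1 := h.div_const x
  have h2 := h1.sub (hasSum_ite_eq (0 : ℕ) (1 : ℝ))
  refine h2.congr_fun fun k => ?_
  simp only [sinhcSeries, PowerSeries.coeff_mk]
  split_ifs with hk
  · subst hk; simp [hx]
  · field_simp
    ring

theorem hasSum_sinhcSeries_sinh {x : ℝ} (hx : x ≠ 0) :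
    HasSum (fun k => PowerSeries.coeff k sinhcSeries * (x ^ 2) ^ k) (Real.sinh x / x - 1) := by
  refine hasSum_sinhcSeries hx ?_
  simpa only [pow_succ, pow_mul, pow_zero, one_mul] using Real.hasSum_sinh x

theorem hasSum_sinhcSeries_sin {x : ℝ} (hx : x ≠ 0) :
    HasSum (fun k => PowerSeries.coeff k sinhcSeries * (-x ^ 2) ^ k) (Real.sin x / x - 1) := by
  refine hasSum_sinhcSeries hx ?_
  refine (Real.hasSum_sin x).congr_fun fun k => ?_
  rw [neg_pow, pow_succ x (2 * k), pow_mul]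
  ring

theorem coeff_sinhcSeries_nonneg (k : ℕ) : 0 ≤ PowerSeries.coeff k sinhcSeries := by
  simpa using coeff_sinhcSeries_pow_nonneg 1 k

theorem summable_norm_sinhcSeries (u : ℝ) :
    Summable fun k => ‖PowerSeries.coeff k sinhcSeries * u ^ k‖ := by
  rcases eq_or_ne u 0 with rfl | hu
  · exact summable_of_ne_finset_zero (s := {0}) fun k hk => by
      simp at hk
      simp [hk]
  · have h0 : √|u| ≠ 0 := by positivity
    have h := (hasSum_sinhcSeries_sinh h0).summable
    rw [Real.sq_sqrt (abs_nonneg u)] at h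
    refine h.congr fun k => ?_
    rw [norm_mul, norm_pow, Real.norm_of_nonneg (coeff_sinhcSeries_nonneg k), Real.norm_eq_abs]

theorem hasSum_sinhcSeries_pow_sinh {x : ℝ} (hx : x ≠ 0) (n : ℕ) :
    HasSum (fun k => PowerSeries.coeff k (sinhcSeries ^ n) * (x ^ 2) ^ k)
      ((Real.sinh x / x - 1) ^ n) :=
  (hasSum_coeff_pow (summable_norm_sinhcSeries _) (hasSum_sinhcSeries_sinh hx) n).2

theorem hasSum_sinhcSeries_pow_sin {x : ℝ} (hx : x ≠ 0) (n : ℕ) :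
    HasSum (fun k => PowerSeries.coeff k (sinhcSeries ^ n) * (-x ^ 2) ^ k)
      ((Real.sin x / x - 1) ^ n) :=
  (hasSum_coeff_pow (summable_norm_sinhcSeries _) (hasSum_sinhcSeries_sin hx) n).2

/-! ### The double series and its iterated antiderivatives. -/

/-- The coefficients of the double series expansion of `(x / sin x)² - 1`. -/
noncomputable def sincInvSqCoeff (p : ℕ × ℕ) : ℝ :=
  (-1) ^ p.2 * (p.1 + 2) * PowerSeries.coeff (p.1 + p.2 + 1) (sinhcSeries ^ (p.1 + 1))

theorem hasSum_shift_coeff_pow {u v : ℝ} (n : ℕ)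
    (h : HasSum (fun k => PowerSeries.coeff k (sinhcSeries ^ (n + 1)) * u ^ k) v) :
    HasSum (fun l => PowerSeries.coeff (n + l + 1) (sinhcSeries ^ (n + 1)) * u ^ (n + l + 1)) v := by
  have h1 := (hasSum_nat_add_iff' (n + 1)).2 h
  rw [Finset.sum_eq_zero, sub_zero] at h1
  · refine h1.congr_fun fun l => ?_
    rw [show n + l + 1 = l + (n + 1) by ring]
  · intro i hi
    rw [coeff_sinhcSeries_pow_of_lt (by simpa using hi), zero_mul]

theorem hasSum_add_two_mul_pow {t : ℝ} (ht : ‖t‖ < 1) :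
    HasSum (fun n : ℕ => ((n : ℝ) + 2) * t ^ (n + 1)) (1 / (1 - t) ^ 2 - 1) := by
  have h := (hasSum_coe_mul_geometric_of_norm_lt_one ht).add (hasSum_geometric_of_norm_lt_one ht)
  have h1 := (hasSum_nat_add_iff' 1).2 h
  have hne : 1 - t ≠ 0 := by
    intro h0
    have : t = 1 := by linarith
    rw [this] at ht
    simp at ht
  convert! h1 using 1
  · funext n
    push_cast
    ring
  · simp
    field_simp
    ring

/-- Dropping the signs replaces `sin` by `sinh` at `x = 1`; the inner sums are `(n+2)(sinh 1 -
1)^(n+1)`, an arithmetico-geometric series of ratio below `1`. -/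
theorem summable_norm_sincInvSqCoeff : Summable fun p => ‖sincInvSqCoeff p‖ := by
  have hn : ∀ p, ‖sincInvSqCoeff p‖ =
      (p.1 + 2) * PowerSeries.coeff (p.1 + p.2 + 1) (sinhcSeries ^ (p.1 + 1)) := by
    intro p
    rw [sincInvSqCoeff, norm_mul, norm_mul, norm_pow, norm_neg, norm_one, one_pow, one_mul,
      Real.norm_of_nonneg (coeff_sinhcSeries_pow_nonneg _ _), Real.norm_of_nonneg (by positivity)]
  have hs : ∀ n : ℕ, HasSum (fun l : ℕ => ‖sincInvSqCoeff (n, l)‖)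
      ((n + 2) * (Real.sinh 1 - 1) ^ (n + 1)) := by
    intro n
    have h := hasSum_shift_coeff_pow n (hasSum_sinhcSeries_pow_sinh one_ne_zero (n + 1))
    simp only [one_pow, mul_one, div_one] at h
    simpa only [hn] using h.mul_left ((n : ℝ) + 2)
  rw [summable_prod_of_nonneg fun p => norm_nonneg _]
  refine ⟨fun n => (hs n).summable, ?_⟩
  simp_rw [fun n => (hs n).tsum_eq]
  refine (hasSum_add_two_mul_pow ?_).summable
  have h1 : Real.sinh 1 < 2 := by
    rw [Real.sinh_eq]
    have := Real.exp_one_lt_d9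
    have := Real.exp_pos (-1)
    linarith
  have h2 : 0 < Real.sinh 1 := Real.sinh_pos_iff.2 one_pos
  rw [Real.norm_eq_abs, abs_lt]
  constructor <;> linarith

/-- The `r`-fold antiderivative, vanishing at `0`, of `1 / sin² x - 1 / x²`, as a double series. -/
noncomputable def iteratedSeries (r : ℕ) (x : ℝ) : ℝ :=
  ∑' p : ℕ × ℕ, sincInvSqCoeff p * x ^ (2 * (p.1 + p.2) + r) /
    ∏ i ∈ Finset.range r, (2 * ((p.1 : ℝ) + p.2) + 1 + i)

theorem one_le_prod_range (r : ℕ) {a : ℝ} (ha : 0 ≤ a) :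
    1 ≤ ∏ i ∈ Finset.range r, (a + 1 + (i : ℝ)) := by
  refine Finset.prod_induction _ (fun y : ℝ => 1 ≤ y) (fun _ _ => one_le_mul_of_one_le_of_one_le)
    le_rfl fun i _ => ?_
  have : (0 : ℝ) ≤ i := i.cast_nonneg
  linarith

/-- The bound is independent of `x`, `r` and `s`, so it serves both summability and termwise
differentiation. -/
theorem norm_iteratedSeries_term_le (r s : ℕ) {x : ℝ} (hx : |x| ≤ 1) (p : ℕ × ℕ) :
    ‖sincInvSqCoeff p * x ^ s / ∏ i ∈ Finset.range r, (2 * ((p.1 : ℝ) + p.2) + 1 + i)‖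
      ≤ ‖sincInvSqCoeff p‖ := by
  have h1 := one_le_prod_range r (a := 2 * ((p.1 : ℝ) + p.2)) (by positivity)
  rw [norm_div, norm_mul, norm_pow, Real.norm_eq_abs x,
    Real.norm_of_nonneg (zero_le_one.trans h1)]
  refine (div_le_self (by positivity) h1).trans ?_
  exact mul_le_of_le_one_right (norm_nonneg _) (pow_le_one₀ (abs_nonneg x) hx)

theorem summable_iteratedSeries (r s : ℕ) {x : ℝ} (hx : |x| ≤ 1) :
    Summable fun p : ℕ × ℕ => sincInvSqCoeff p * x ^ (2 * (p.1 + p.2) + s) /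
      ∏ i ∈ Finset.range r, (2 * ((p.1 : ℝ) + p.2) + 1 + i) :=
  .of_norm_bounded summable_norm_sincInvSqCoeff fun p => norm_iteratedSeries_term_le r _ hx p

theorem hasDerivAt_iteratedSeries (r : ℕ) {x : ℝ} (hx : |x| < 1) :
    HasDerivAt (iteratedSeries (r + 1)) (iteratedSeries r x) x := by
  have hmem : ∀ y : ℝ, y ∈ Metric.ball (0 : ℝ) 1 ↔ |y| < 1 := fun y => by simp
  refine hasDerivAt_tsum_of_isPreconnected
    (g := fun (p : ℕ × ℕ) (y : ℝ) => sincInvSqCoeff p * y ^ (2 * (p.1 + p.2) + (r + 1)) /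
      ∏ i ∈ Finset.range (r + 1), (2 * ((p.1 : ℝ) + p.2) + 1 + i))
    (g' := fun (p : ℕ × ℕ) (y : ℝ) => sincInvSqCoeff p * y ^ (2 * (p.1 + p.2) + r) /
      ∏ i ∈ Finset.range r, (2 * ((p.1 : ℝ) + p.2) + 1 + i))
    summable_norm_sincInvSqCoeff Metric.isOpen_ball
    (convex_ball (0 : ℝ) 1).isPreconnected (fun p y hy => ?_)
    (fun p y hy => norm_iteratedSeries_term_le r _ ((hmem y).1 hy).le p)
    (Metric.mem_ball_self one_pos) (summable_iteratedSeries _ _ (by simp)) ((hmem x).2 hx)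
  rw [Finset.prod_range_succ]
  have h1 : ∏ i ∈ Finset.range r, (2 * ((p.1 : ℝ) + p.2) + 1 + i) ≠ 0 :=
    (zero_lt_one.trans_le (one_le_prod_range r (by positivity))).ne'
  have h2 : (2 * ((p.1 : ℝ) + p.2) + 1 + r) ≠ 0 := by positivity
  refine (((hasDerivAt_pow (2 * (p.1 + p.2) + (r + 1)) y).const_mul
    (sincInvSqCoeff p)).div_const _).congr_deriv ?_
  rw [show 2 * (p.1 + p.2) + (r + 1) - 1 = 2 * (p.1 + p.2) + r by omega]
  push_cast
  field_simp
  ring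

theorem iteratedSeries_succ_zero (r : ℕ) : iteratedSeries (r + 1) 0 = 0 := by
  simp [iteratedSeries, ← add_assoc]

theorem tendsto_iteratedSeries_succ (r : ℕ) :
    Tendsto (iteratedSeries (r + 1)) (𝓝[>] 0) (𝓝 0) := by
  have h := (hasDerivAt_iteratedSeries r (x := 0) (by simp)).continuousAt.tendsto
  rw [iteratedSeries_succ_zero] at h
  exact h.mono_left nhdsWithin_le_nhds

/-- Summing over `l` first gives a power of `1 - sin x / x`; the sum over `n` is then the expansion
of `1/(1-t)² - 1`. -/
theorem iteratedSeries_zero {x : ℝ} (h0 : 0 < x) (h1 : x < 1) :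
    iteratedSeries 0 x = 1 / Real.sin x ^ 2 - 1 / x ^ 2 := by
  have hs0 : 0 < Real.sin x := Real.sin_pos_of_pos_of_lt_pi h0 (by linarith [Real.pi_gt_three])
  have hs1 : Real.sin x < x := Real.sin_lt h0
  have hsum := summable_iteratedSeries 0 0 (x := x) (by rw [abs_of_pos h0]; exact h1.le)
  have hin : ∀ n : ℕ, HasSum (fun l : ℕ => sincInvSqCoeff (n, l) * x ^ (2 * (n + l) + 0) /
      ∏ i ∈ Finset.range 0, (2 * ((n : ℝ) + l) + 1 + i))
      ((n + 2) * (1 - Real.sin x / x) ^ (n + 1) / x ^ 2) := by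
    intro n
    have h := (hasSum_shift_coeff_pow n (hasSum_sinhcSeries_pow_sin h0.ne' (n + 1))).mul_left
      ((n + 2 : ℝ) * (-1) ^ (n + 1) / x ^ 2)
    convert! h using 1
    · funext l
      -- The sign `(-1)^(n+1)` from `t = -(sin x / x - 1)` cancels against `(-x²)^(n+1+l)`, leaving
      -- only `(-1)^l`.
      have e : (-1 : ℝ) ^ (n + 1) * (-1) ^ (n + 1) = 1 := by
        rw [← mul_pow]; simp
      simp only [sincInvSqCoeff, Finset.range_zero, Finset.prod_empty, div_one, add_zero]
      rw [neg_pow (x ^ 2), show n + l + 1 = (n + 1) + l by ring, pow_add (-1 : ℝ) (n + 1) l,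
        ← pow_mul, show 2 * (n + 1 + l) = 2 * (n + l) + 2 by ring, pow_add x]
      rw [div_mul_eq_mul_div, eq_div_iff (pow_ne_zero 2 h0.ne')]
      linear_combination (-(x ^ (2 * (n + l)) * x ^ 2 * (n + 2) * (-1) ^ l *
        PowerSeries.coeff (n + 1 + l) (sinhcSeries ^ (n + 1)))) * e
    · rw [show Real.sin x / x - 1 = -(1 - Real.sin x / x) by ring, neg_pow (1 - Real.sin x / x)]
      have e : (-1 : ℝ) ^ (n + 1) * (-1) ^ (n + 1) = 1 := by
        rw [← mul_pow]; simp
      linear_combination (-((n + 2 : ℝ) / x ^ 2 * (1 - Real.sin x / x) ^ (n + 1))) * e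
  rw [iteratedSeries, hsum.tsum_prod' fun n => (hin n).summable]
  simp_rw [fun n => (hin n).tsum_eq]
  have ht : ‖1 - Real.sin x / x‖ < 1 := by
    have e1 : Real.sin x / x < 1 := (div_lt_one h0).2 hs1
    have e2 : 0 < Real.sin x / x := by positivity
    rw [Real.norm_eq_abs, abs_lt]
    constructor <;> linarith
  rw [((hasSum_add_two_mul_pow ht).div_const (x ^ 2)).tsum_eq, sub_sub_cancel]
  field_simp

/-! ### Closed forms of orders one and two. -/

theorem eqOn_of_hasDerivAt_of_tendsto {F G f : ℝ → ℝ}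
    (hF : ∀ x, 0 < x → x < 1 → HasDerivAt F (f x) x)
    (hG : ∀ x, 0 < x → x < 1 → HasDerivAt G (f x) x)
    (hF0 : Tendsto F (𝓝[>] 0) (𝓝 0)) (hG0 : Tendsto G (𝓝[>] 0) (𝓝 0))
    {x : ℝ} (h0 : 0 < x) (h1 : x < 1) : F x = G x := by
  obtain ⟨c, hc⟩ := isOpen_Ioo.exists_is_const_of_deriv_eq_zero (𝕜 := ℝ) (f := F - G)
    (convex_Ioo (0 : ℝ) 1).isPreconnected
    (fun y hy => ((hF y hy.1 hy.2).sub (hG y hy.1 hy.2)).differentiableAt.differentiableWithinAt)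
    (fun y hy => by simpa using ((hF y hy.1 hy.2).sub (hG y hy.1 hy.2)).deriv)
  have ht : Tendsto (F - G) (𝓝[>] 0) (𝓝 0) := by
    simpa only [sub_zero] using! hF0.sub hG0
  have ht2 : Tendsto (F - G) (𝓝[>] 0) (𝓝 c) :=
    tendsto_const_nhds.congr' (by
      filter_upwards [Ioo_mem_nhdsGT (one_pos : (0 : ℝ) < 1)] with y hy using (hc y hy).symm)
  have := hc x ⟨h0, h1⟩
  rw [tendsto_nhds_unique ht2 ht, Pi.sub_apply] at this
  linarith

/-- Squeezed between `0`, from `x < tan x`, and `x`, from polynomial bounds on `sin` and `cos`. -/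
theorem tendsto_inv_sub_cot :
    Tendsto (fun x => 1 / x - Real.cos x / Real.sin x) (𝓝[>] 0) (𝓝 0) := by
  have h2 : Tendsto (fun x : ℝ => x) (𝓝[>] 0) (𝓝 0) := nhdsWithin_le_nhds
  refine tendsto_of_tendsto_of_tendsto_of_le_of_le' tendsto_const_nhds h2 ?_ ?_
  all_goals
    filter_upwards [Ioo_mem_nhdsGT (one_pos : (0 : ℝ) < 1)] with x hx
    have h0 : 0 < x := hx.1
    have h1 : x < 1 := hx.2
    have hs0 : 0 < Real.sin x :=
      Real.sin_pos_of_pos_of_lt_pi h0 (by linarith [Real.pi_gt_three])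
    have hs1 : Real.sin x < x := Real.sin_lt h0
    have hs2 := Real.sin_gt_sub_cube h0
    have hc := Real.one_sub_sq_div_two_le_cos (x := x)
    have hx2 : x ^ 2 ≤ 1 := by nlinarith
    rw [div_sub_div _ _ h0.ne' hs0.ne']
  · refine div_nonneg ?_ (by positivity)
    have hc2 : 0 < Real.cos x :=
      Real.cos_pos_of_mem_Ioo ⟨by linarith [Real.pi_gt_three], by linarith [Real.pi_gt_three]⟩
    have := Real.lt_tan h0 (by linarith [Real.pi_gt_three])
    rw [Real.tan_eq_sin_div_cos, lt_div_iff₀ hc2] at this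
    linarith
  · rw [div_le_iff₀ (by positivity)]
    nlinarith [mul_pos h0 h0, mul_le_mul_of_nonneg_left hc h0.le,
      mul_le_mul_of_nonneg_left hs2.le (sq_nonneg x), mul_le_mul_of_nonneg_left hx2 (pow_pos h0 3).le]

theorem iteratedSeries_one {x : ℝ} (h0 : 0 < x) (h1 : x < 1) :
    iteratedSeries 1 x = 1 / x - Real.cos x / Real.sin x := by
  refine eqOn_of_hasDerivAt_of_tendsto (f := fun x => 1 / Real.sin x ^ 2 - 1 / x ^ 2)
    (G := fun x => 1 / x - Real.cos x / Real.sin x)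
    (fun y hy0 hy1 => ?_) (fun y hy0 hy1 => ?_) (tendsto_iteratedSeries_succ 0)
    tendsto_inv_sub_cot h0 h1
  · rw [← iteratedSeries_zero hy0 hy1]
    exact hasDerivAt_iteratedSeries 0 (by rwa [abs_of_pos hy0])
  · have hs0 : 0 < Real.sin y :=
      Real.sin_pos_of_pos_of_lt_pi hy0 (by linarith [Real.pi_gt_three])
    have h := (hasDerivAt_inv hy0.ne').sub
      ((Real.hasDerivAt_cos y).div (Real.hasDerivAt_sin y) hs0.ne')
    simp only [one_div]
    refine h.congr_deriv ?_
    field_simp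
    linear_combination (y ^ 2) * Real.sin_sq_add_cos_sq y

theorem iteratedSeries_two {x : ℝ} (h0 : 0 < x) (h1 : x < 1) :
    iteratedSeries 2 x = Real.log x - Real.log (Real.sin x) := by
  have hsin : ∀ y : ℝ, 0 < y → y < 1 → 0 < Real.sin y := fun y hy0 hy1 =>
    Real.sin_pos_of_pos_of_lt_pi hy0 (by linarith [Real.pi_gt_three])
  refine eqOn_of_hasDerivAt_of_tendsto (f := fun x => 1 / x - Real.cos x / Real.sin x)
    (G := fun x => Real.log x - Real.log (Real.sin x))
    (fun y hy0 hy1 => ?_) (fun y hy0 hy1 => ?_) (tendsto_iteratedSeries_succ 1) ?_ h0 h1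
  · rw [← iteratedSeries_one hy0 hy1]
    exact hasDerivAt_iteratedSeries 1 (by rwa [abs_of_pos hy0])
  · rw [one_div]
    exact (Real.hasDerivAt_log hy0.ne').sub ((Real.hasDerivAt_sin y).log (hsin y hy0 hy1).ne')
  · have h : Tendsto (fun y => -Real.log (Real.sinc y)) (𝓝[>] 0) (𝓝 0) := by
      have hc : ContinuousAt (fun y => -Real.log (Real.sinc y)) 0 :=
        (Real.continuous_sinc.continuousAt.log (by simp)).neg
      have := hc.tendsto
      simp only [Real.sinc_zero, Real.log_one, neg_zero] at this
      exact this.mono_left nhdsWithin_le_nhds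
    refine h.congr' ?_
    filter_upwards [Ioo_mem_nhdsGT (one_pos : (0 : ℝ) < 1)] with y hy
    rw [Real.sinc_of_ne_zero hy.1.ne', Real.log_div (hsin y hy.1 hy.2).ne' hy.1.ne']
    ring

/-! ### The outer series as the double series at `π/6`. -/

theorem baseX_sq : baseX ^ 2 * 6 = (Real.pi / 6) ^ 2 := by
  rw [baseX, div_pow, mul_pow, Real.sq_sqrt (by norm_num)]
  ring

/-- The power `6^(n+l+1)` in the P-value turns `baseX^(2(n+l+2))` into `(π/6)^(2(n+l+2)) / 6`, and
its denominator `n+1` reduces `(n+1)(n+2)` to `n+2`. -/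
theorem coeffTerm_eq (r l n : ℕ) :
    (-1) ^ (l + 1 + 1) * coeffTerm r (l + 1) (n + 1) * baseX ^ (2 * (l + 1)) =
      (sincInvSqCoeff (n, l) * (Real.pi / 6) ^ (2 * (n + l) + 4) /
        ∏ i ∈ Finset.range r, (2 * ((n : ℝ) + l) + 1 + i)) / 6 := by
  have h1 : ∏ i ∈ Finset.range r, (2 * ((n : ℝ) + l) + 1 + i) ≠ 0 :=
    (zero_lt_one.trans_le (one_le_prod_range r (by positivity))).ne'
  have h2 : ∏ i ∈ Finset.range r, (2 * ((n + 1 : ℕ) : ℝ) + 2 * ((l + 1 : ℕ) : ℝ) - 3 + (i : ℝ))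
      = ∏ i ∈ Finset.range r, (2 * ((n : ℝ) + l) + 1 + i) := by
    refine Finset.prod_congr rfl fun i _ => ?_
    push_cast
    ring
  rw [coeffTerm, h2, show n + 1 + (l + 1) - 1 = n + l + 1 by omega, bernoulliP_eq_coeff,
    sincInvSqCoeff]
  rw [show 2 * (n + l) + 4 = 2 * (n + l + 2) by ring, pow_mul (Real.pi / 6), ← baseX_sq]
  push_cast
  field_simp
  ring

theorem abs_pi_div_six_lt_one : |Real.pi / 6| < 1 := by
  rw [abs_of_pos (by positivity)]
  linarith [Real.pi_lt_four]

/-- A slice of the summable double family, up to a nonzero constant. -/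
theorem summable_coeffTerm (r : ℕ) (l : ℕ) (hl : 1 ≤ l) :
    Summable fun n : ℕ => coeffTerm r l (n + 1) := by
  obtain ⟨l, rfl⟩ := Nat.exists_eq_add_of_le' hl
  have h := ((summable_iteratedSeries r 4 abs_pi_div_six_lt_one.le).div_const 6).prod_symm.prod_factor l
  have hne : (-1 : ℝ) ^ (l + 1 + 1) * baseX ^ (2 * (l + 1)) ≠ 0 := by
    unfold baseX; positivity
  rw [← summable_mul_left_iff hne]
  refine h.congr fun n => ?_
  have := coeffTerm_eq r l n
  simp only [Prod.swap]
  rw [← this]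
  ring

theorem hasSum_outerTerm (r : ℕ) :
    HasSum (fun l => outerTerm r (l + 1))
      ((Real.pi / 6) ^ 4 * iteratedSeries r (Real.pi / 6) / (6 * (Real.pi / 6) ^ r)) := by
  have hs := ((summable_iteratedSeries r 4 abs_pi_div_six_lt_one.le).div_const 6).prod_symm
  have hin : ∀ l, outerTerm r (l + 1) =
      ∑' n : ℕ, (sincInvSqCoeff (n, l) * (Real.pi / 6) ^ (2 * (n + l) + 4) /
        ∏ i ∈ Finset.range r, (2 * ((n : ℝ) + l) + 1 + i)) / 6 := by
    intro l
    simp_rw [← coeffTerm_eq]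
    rw [tsum_mul_right, tsum_mul_left, outerTerm, coeffC]
  have h := hs.hasSum.prod_fiberwise fun l => (hs.prod_factor l).hasSum
  convert! h using 1
  · funext l
    exact hin l
  · rw [← (Equiv.prodComm ℕ ℕ).tsum_eq]
    simp only [Equiv.prodComm_apply, Prod.swap_swap, iteratedSeries]
    rw [mul_div_assoc, ← tsum_div_const, ← tsum_mul_left]
    refine tsum_congr fun p => ?_
    simp only [pow_add]
    field_simp

/-! ### Clausen-type series and their derivatives. -/

/-- The series `∑_{k ≥ 1} sin(2kx) / k^s`; the term `k = 0` vanishes for `s ≥ 1`. -/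
noncomputable def clausenSin (s : ℕ) (x : ℝ) : ℝ := ∑' k : ℕ, Real.sin (2 * k * x) / (k : ℝ) ^ s

/-- The series `∑_{k ≥ 1} cos(2kx) / k^s`; the term `k = 0` vanishes for `s ≥ 1`. -/
noncomputable def clausenCos (s : ℕ) (x : ℝ) : ℝ := ∑' k : ℕ, Real.cos (2 * k * x) / (k : ℝ) ^ s

theorem norm_sin_div_le (s k : ℕ) (y : ℝ) :
    ‖Real.sin y / (k : ℝ) ^ s‖ ≤ 1 / (k : ℝ) ^ s := by
  rw [norm_div, Real.norm_of_nonneg (by positivity : (0 : ℝ) ≤ (k : ℝ) ^ s)]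
  exact div_le_div_of_nonneg_right (Real.abs_sin_le_one y) (by positivity)

theorem norm_cos_div_le (s k : ℕ) (y : ℝ) :
    ‖Real.cos y / (k : ℝ) ^ s‖ ≤ 1 / (k : ℝ) ^ s := by
  rw [norm_div, Real.norm_of_nonneg (by positivity : (0 : ℝ) ≤ (k : ℝ) ^ s)]
  exact div_le_div_of_nonneg_right (Real.abs_cos_le_one y) (by positivity)

theorem continuous_clausenSin {s : ℕ} (hs : 1 < s) : Continuous (clausenSin s) :=
  continuous_tsum (fun k => by fun_prop) (Real.summable_one_div_nat_pow.2 hs)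
    fun k y => norm_sin_div_le s k _

theorem clausenSin_zero (s : ℕ) : clausenSin s 0 = 0 := by simp [clausenSin]

theorem continuous_clausenCos {s : ℕ} (hs : 1 < s) : Continuous (clausenCos s) :=
  continuous_tsum (fun k => by fun_prop) (Real.summable_one_div_nat_pow.2 hs)
    fun k y => norm_cos_div_le s k _

theorem hasDerivAt_sin_two_mul (k : ℕ) (y : ℝ) :
    HasDerivAt (fun y => Real.sin (2 * k * y)) (2 * k * Real.cos (2 * k * y)) y := by
  have h := (hasDerivAt_id y).const_mul (2 * k : ℝ)
  simpa [mul_comm] using h.sin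

theorem hasDerivAt_cos_two_mul (k : ℕ) (y : ℝ) :
    HasDerivAt (fun y => Real.cos (2 * k * y)) (-(2 * k * Real.sin (2 * k * y))) y := by
  have h := (hasDerivAt_id y).const_mul (2 * k : ℝ)
  simpa [mul_comm] using h.cos

theorem hasDerivAt_clausenSin {s : ℕ} (hs : 1 < s) (x : ℝ) :
    HasDerivAt (clausenSin (s + 1)) (2 * clausenCos s x) x := by
  rw [clausenCos, ← tsum_mul_left]
  refine hasDerivAt_tsum (g := fun (k : ℕ) (y : ℝ) => Real.sin (2 * k * y) / (k : ℝ) ^ (s + 1))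
    (g' := fun (k : ℕ) (y : ℝ) => 2 * (Real.cos (2 * k * y) / (k : ℝ) ^ s)) (y₀ := 0)
    ((Real.summable_one_div_nat_pow.2 hs).mul_left 2) (fun k y => ?_) (fun k y => ?_) ?_ x
  · refine ((hasDerivAt_sin_two_mul k y).div_const _).congr_deriv ?_
    rcases eq_or_ne (k : ℝ) 0 with h | h
    · simp [h, (zero_lt_one.trans hs).ne']
    · field_simp
      ring
  · rw [norm_mul, Real.norm_of_nonneg zero_le_two]
    exact mul_le_mul_of_nonneg_left (norm_cos_div_le s k _) zero_le_two
  · simp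

theorem hasDerivAt_clausenCos {s : ℕ} (hs : 1 < s) (x : ℝ) :
    HasDerivAt (clausenCos (s + 1)) (-(2 * clausenSin s x)) x := by
  rw [clausenSin, ← tsum_mul_left, ← tsum_neg]
  refine hasDerivAt_tsum (g := fun (k : ℕ) (y : ℝ) => Real.cos (2 * k * y) / (k : ℝ) ^ (s + 1))
    (g' := fun (k : ℕ) (y : ℝ) => -(2 * (Real.sin (2 * k * y) / (k : ℝ) ^ s))) (y₀ := 0)
    ((Real.summable_one_div_nat_pow.2 hs).mul_left 2) (fun k y => ?_) (fun k y => ?_) ?_ x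
  · refine ((hasDerivAt_cos_two_mul k y).div_const _).congr_deriv ?_
    rcases eq_or_ne (k : ℝ) 0 with h | h
    · simp [h, (zero_lt_one.trans hs).ne']
    · field_simp
      ring
  · rw [norm_neg, norm_mul, Real.norm_of_nonneg zero_le_two]
    exact mul_le_mul_of_nonneg_left (norm_sin_div_le s k _) zero_le_two
  · simpa using Real.summable_one_div_nat_pow.2 (by omega : 1 < s + 1)

/-! ### The derivative of `∑ sin(2kx)/k²`, whose termwise derivative does not converge absolutely,
by Abel means. -/

/-- The Abel means `∑_{k ≥ 1} r^k sin(2kx) / k²` of `clausenSin 2`. -/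
noncomputable def abelClausen (r x : ℝ) : ℝ :=
  ∑' k : ℕ, r ^ k * (Real.sin (2 * k * x) / (k : ℝ) ^ 2)

/-- Real part of `-log (1 - z)` at `z = r e^(2ix)`, where `|1 - z|² = (1-r)² + 4r sin² x`. -/
theorem hasSum_pow_mul_cos_div {r : ℝ} (h0 : 0 ≤ r) (h1 : r < 1) (x : ℝ) :
    HasSum (fun k : ℕ => r ^ k * (Real.cos (2 * k * x) / k))
      (-(Real.log ((1 - r) ^ 2 + 4 * r * Real.sin x ^ 2) / 2)) := by
  set z : ℂ := r * Complex.exp ((2 * x : ℝ) * Complex.I) with hz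
  have hzn : ‖z‖ < 1 := by
    rw [hz, norm_mul, Complex.norm_exp_ofReal_mul_I, mul_one, Complex.norm_real,
      Real.norm_of_nonneg h0]
    exact h1
  have h := Complex.hasSum_re (Complex.hasSum_taylorSeries_neg_log hzn)
  convert! h using 1
  · funext k
    have e : z ^ k / k = ((r ^ k / k : ℝ) : ℂ) * Complex.exp ((2 * k * x : ℝ) * Complex.I) := by
      rw [hz, mul_pow, ← Complex.exp_nat_mul]
      push_cast
      rw [show (k : ℂ) * (2 * x * Complex.I) = 2 * k * x * Complex.I by ring]
      ring
    rw [e, Complex.re_ofReal_mul, Complex.exp_ofReal_mul_I_re]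
    ring
  · rw [Complex.neg_re, Complex.log_re]
    have e : (1 - r) ^ 2 + 4 * r * Real.sin x ^ 2 = ‖1 - z‖ ^ 2 := by
      rw [Complex.sq_norm, Complex.normSq_apply, Complex.sub_re, Complex.sub_im, hz,
        Complex.re_ofReal_mul, Complex.im_ofReal_mul, Complex.exp_ofReal_mul_I_re,
        Complex.exp_ofReal_mul_I_im]
      have h1 := Real.sin_sq_add_cos_sq (2 * x)
      have h2 := Real.cos_two_mul x
      have h3 := Real.sin_sq_add_cos_sq x
      simp only [Complex.one_re, Complex.one_im]
      linear_combination (-r ^ 2) * h1 + 2 * r * h2 + 4 * r * h3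
    rw [e, Real.log_pow]
    push_cast
    ring

theorem hasDerivAt_abelClausen {r : ℝ} (h0 : 0 ≤ r) (h1 : r < 1) (x : ℝ) :
    HasDerivAt (abelClausen r) (-Real.log ((1 - r) ^ 2 + 4 * r * Real.sin x ^ 2)) x := by
  have e := ((hasSum_pow_mul_cos_div h0 h1 x).mul_left 2).tsum_eq
  rw [show 2 * -(Real.log ((1 - r) ^ 2 + 4 * r * Real.sin x ^ 2) / 2) =
    -Real.log ((1 - r) ^ 2 + 4 * r * Real.sin x ^ 2) by ring] at e
  rw [← e]
  refine hasDerivAt_tsum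
    (g := fun (k : ℕ) (y : ℝ) => r ^ k * (Real.sin (2 * k * y) / (k : ℝ) ^ 2))
    (g' := fun (k : ℕ) (y : ℝ) => 2 * (r ^ k * (Real.cos (2 * k * y) / k))) (y₀ := 0)
    ((summable_geometric_of_lt_one h0 h1).mul_left 2) (fun k y => ?_) (fun k y => ?_) ?_ x
  · refine (((hasDerivAt_sin_two_mul k y).div_const _).const_mul _).congr_deriv ?_
    rcases eq_or_ne (k : ℝ) 0 with h | h
    · simp [h]
    · field_simp
  · have hk : ‖Real.cos (2 * k * y) / (k : ℝ)‖ ≤ 1 := by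
      have := norm_cos_div_le 1 k (2 * k * y)
      rw [pow_one] at this
      refine this.trans ?_
      rcases Nat.eq_zero_or_pos k with rfl | hk
      · simp
      · rw [div_le_one (by exact_mod_cast hk)]
        exact_mod_cast hk
    rw [norm_mul, norm_mul, Real.norm_of_nonneg zero_le_two,
      Real.norm_of_nonneg (pow_nonneg h0 k)]
    exact mul_le_mul_of_nonneg_left (mul_le_of_le_one_right (pow_nonneg h0 k) hk) zero_le_two
  · simp

theorem tendsto_abelClausen (x : ℝ) :
    Tendsto (fun r => abelClausen r x) (𝓝[<] 1) (𝓝 (clausenSin 2 x)) := by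
  refine tendsto_tsum_of_dominated_convergence (bound := fun k : ℕ => 1 / (k : ℝ) ^ 2)
    (Real.summable_one_div_nat_pow.2 one_lt_two) (fun k => ?_) ?_
  · have : ContinuousAt (fun r : ℝ => r ^ k * (Real.sin (2 * k * x) / (k : ℝ) ^ 2)) 1 := by
      fun_prop
    simpa using this.tendsto.mono_left (nhdsWithin_le_nhds (s := Set.Iio 1))
  · filter_upwards [Ioo_mem_nhdsLT (zero_lt_one : (0 : ℝ) < 1)] with r hr k
    rw [norm_mul, norm_pow, Real.norm_of_nonneg hr.1.le]
    exact (mul_le_of_le_one_left (norm_nonneg _) (pow_le_one₀ hr.1.le hr.2.le)).trans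
      (norm_sin_div_le 2 k _)

theorem sin_pos_of_lt_one {t : ℝ} (h0 : 0 < t) (h1 : t ≤ 1) : 0 < Real.sin t :=
  Real.sin_pos_of_pos_of_lt_pi h0 (by linarith [Real.pi_gt_three])

/-- Integrating before letting `r → 1` needs only dominated convergence. For `1/2 < r < 1` the
argument of the logarithm stays between `2 sin² a` and `5`. -/
theorem clausenSin_two_sub {a b : ℝ} (ha : 0 < a) (hab : a ≤ b) (hb : b ≤ 1) :
    clausenSin 2 b - clausenSin 2 a = ∫ t in a..b, -Real.log (4 * Real.sin t ^ 2) := by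
  have hsa : 0 < Real.sin a := sin_pos_of_lt_one ha (hab.trans hb)
  have hlow : ∀ r : ℝ, 1 / 2 < r → ∀ t, a ≤ t → t ≤ b →
      2 * Real.sin a ^ 2 ≤ (1 - r) ^ 2 + 4 * r * Real.sin t ^ 2 := by
    intro r hr t ht1 ht2
    have h1 : Real.sin a ≤ Real.sin t :=
      Real.sin_le_sin_of_le_of_le_pi_div_two (by linarith [Real.pi_gt_three])
        (by linarith [Real.pi_gt_three]) ht1
    have h2 : Real.sin a ^ 2 ≤ Real.sin t ^ 2 := pow_le_pow_left₀ hsa.le h1 2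
    nlinarith [sq_nonneg (1 - r), sq_nonneg (Real.sin t)]
  have hpos : ∀ r : ℝ, 1 / 2 < r → ∀ t, a ≤ t → t ≤ b →
      0 < (1 - r) ^ 2 + 4 * r * Real.sin t ^ 2 := fun r hr t h1 h2 =>
    lt_of_lt_of_le (by positivity) (hlow r hr t h1 h2)
  have hcont : ∀ r : ℝ, 1 / 2 < r →
      ContinuousOn (fun t => -Real.log ((1 - r) ^ 2 + 4 * r * Real.sin t ^ 2))
        (Set.uIcc a b) := by
    intro r hr
    rw [Set.uIcc_of_le hab]
    exact (ContinuousOn.log (by fun_prop) fun t ht => (hpos r hr t ht.1 ht.2).ne').neg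
  have hev : ∀ᶠ r : ℝ in 𝓝[<] 1, 1 / 2 < r ∧ r < 1 := Ioo_mem_nhdsLT (by norm_num)
  have h1 : Tendsto (fun r => ∫ t in a..b, -Real.log ((1 - r) ^ 2 + 4 * r * Real.sin t ^ 2))
      (𝓝[<] 1) (𝓝 (∫ t in a..b, -Real.log (4 * Real.sin t ^ 2))) := by
    refine intervalIntegral.tendsto_integral_filter_of_dominated_convergence
      (fun _ => |Real.log (2 * Real.sin a ^ 2)| + |Real.log 5|) ?_ ?_ (by simp) ?_
    · filter_upwards [hev] with r hr
      exact ((hcont r hr.1).mono Set.uIoc_subset_uIcc).aestronglyMeasurable measurableSet_uIoc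
    · filter_upwards [hev] with r hr
      refine .of_forall fun t ht => ?_
      rw [Set.uIoc_of_le hab] at ht
      have e1 := hlow r hr.1 t ht.1.le ht.2
      have e2 : (1 - r) ^ 2 + 4 * r * Real.sin t ^ 2 ≤ 5 := by
        nlinarith [Real.sin_sq_le_one t, sq_nonneg (Real.sin t)]
      have l1 := Real.log_le_log (by positivity) e1
      have l2 := Real.log_le_log (hpos r hr.1 t ht.1.le ht.2) e2
      rw [norm_neg, Real.norm_eq_abs, abs_le]
      constructor
      · linarith [neg_abs_le (Real.log (2 * Real.sin a ^ 2)), abs_nonneg (Real.log 5)]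
      · linarith [le_abs_self (Real.log 5), abs_nonneg (Real.log (2 * Real.sin a ^ 2))]
    · refine .of_forall fun t ht => ?_
      rw [Set.uIoc_of_le hab] at ht
      have hc : ContinuousAt (fun r : ℝ => -Real.log ((1 - r) ^ 2 + 4 * r * Real.sin t ^ 2)) 1 :=
        (ContinuousAt.log (f := fun r : ℝ => (1 - r) ^ 2 + 4 * r * Real.sin t ^ 2) (by fun_prop)
          (hpos 1 (by norm_num) t ht.1.le ht.2).ne').neg
      simpa using hc.tendsto.mono_left (nhdsWithin_le_nhds (s := Set.Iio 1))
  have h2 := (tendsto_abelClausen b).sub (tendsto_abelClausen a)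
  refine tendsto_nhds_unique h2 (h1.congr' ?_)
  filter_upwards [hev] with r hr
  exact intervalIntegral.integral_eq_sub_of_hasDerivAt
    (fun t _ => hasDerivAt_abelClausen (by linarith [hr.1]) hr.2 t)
    (hcont r hr.1).intervalIntegrable

theorem hasDerivAt_clausenSin_two {x : ℝ} (h0 : 0 < x) (h1 : x < 1) :
    HasDerivAt (clausenSin 2) (-2 * Real.log (2 * Real.sin x)) x := by
  have hc : ContinuousOn (fun t => -Real.log (4 * Real.sin t ^ 2)) (Set.Icc (x / 2) 1) :=
    (ContinuousOn.log (by fun_prop) fun t ht => by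
      have := sin_pos_of_lt_one (lt_of_lt_of_le (by positivity) ht.1) ht.2
      positivity).neg
  have hmem : Set.Icc (x / 2) 1 ∈ 𝓝 x := Icc_mem_nhds (by linarith) h1
  -- The base point `x / 2` keeps the interval away from the logarithmic singularity at `0`.
  have hd := intervalIntegral.integral_hasDerivAt_right (a := x / 2) (b := x)
    (hc.mono (by rw [Set.uIcc_of_le (by linarith)]; exact Set.Icc_subset_Icc_right h1.le)
      |>.intervalIntegrable)
    (hc.stronglyMeasurableAtFilter_nhdsWithin measurableSet_Icc x |>.filter_mono
      (le_of_eq (nhdsWithin_eq_nhds.2 hmem).symm)) (hc.continuousAt hmem)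
  have e : -2 * Real.log (2 * Real.sin x) = -Real.log (4 * Real.sin x ^ 2) := by
    rw [show 4 * Real.sin x ^ 2 = (2 * Real.sin x) ^ 2 by ring, Real.log_pow]
    push_cast
    ring
  rw [e]
  refine (hd.add_const (clausenSin 2 (x / 2))).congr_of_eventuallyEq ?_
  filter_upwards [hmem] with y hy
  rw [← clausenSin_two_sub (by positivity) hy.1 hy.2]
  ring

/-! ### Closed forms of orders three to eight. -/

/-- The real number `ζ(s) = ∑_{n ≥ 1} 1 / n^s`; the term `n = 0` vanishes for `s ≥ 1`. -/
noncomputable def zetaReal (s : ℕ) : ℝ := ∑' n : ℕ, 1 / (n : ℝ) ^ s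

theorem clausenCos_zero (s : ℕ) : clausenCos s 0 = zetaReal s := by
  simp [clausenCos, zetaReal]

theorem riemannZeta_eq_zetaReal {s : ℕ} (hs : 1 < s) : riemannZeta s = (zetaReal s : ℂ) := by
  rw [zeta_nat_eq_tsum_of_gt_one hs, zetaReal]
  push_cast
  rfl

/-- Each integration raises `d` by `1/(m+1)`, so the constants `1, 3/2, 11/6, 25/12, …` below are
harmonic numbers. -/
theorem hasDerivAt_pow_mul_log (m : ℕ) (d : ℝ) {x : ℝ} (hx : 0 < x) :
    HasDerivAt (fun x => x ^ (m + 1) * (Real.log (2 * x) - d))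
      ((m + 1) * (x ^ m * (Real.log (2 * x) - (d - 1 / (m + 1))))) x := by
  have h1 : HasDerivAt (fun x : ℝ => Real.log (2 * x)) (2 / (2 * x)) x := by
    simpa using ((hasDerivAt_id x).const_mul 2).log (by simpa using hx.ne')
  refine ((hasDerivAt_pow (m + 1) x).mul (h1.sub_const d)).congr_deriv ?_
  have : (m + 1 : ℝ) ≠ 0 := by positivity
  rw [Nat.add_sub_cancel]
  push_cast
  field_simp
  ring

theorem continuous_pow_mul_log (m : ℕ) (d : ℝ) :
    Continuous (fun x : ℝ => x ^ (m + 1) * (Real.log (2 * x) - d)) := by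
  have h := Real.continuous_mul_log.comp (continuous_const_mul (2 : ℝ))
  have : (fun x : ℝ => x ^ (m + 1) * (Real.log (2 * x) - d)) =
      fun x => x ^ m / 2 * (2 * x * Real.log (2 * x)) - d * x ^ (m + 1) := by
    funext x
    ring
  rw [this]
  exact (((continuous_pow m).div_const 2).mul h).sub (by fun_prop)

theorem iteratedSeries_succ_eq {r : ℕ} {G f : ℝ → ℝ}
    (hf : ∀ x, 0 < x → x < 1 → iteratedSeries r x = f x)
    (hG : ∀ x, 0 < x → x < 1 → HasDerivAt G (f x) x) (hc : Continuous G) (hG0 : G 0 = 0)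
    (x : ℝ) (h0 : 0 < x) (h1 : x < 1) : iteratedSeries (r + 1) x = G x := by
  refine eqOn_of_hasDerivAt_of_tendsto (f := f) (fun y hy0 hy1 => ?_) hG
    (tendsto_iteratedSeries_succ r) ?_ h0 h1
  · rw [← hf y hy0 hy1]
    exact hasDerivAt_iteratedSeries r (by rwa [abs_of_pos hy0])
  · have := hc.tendsto 0
    rw [hG0] at this
    exact this.mono_left nhdsWithin_le_nhds

theorem iteratedSeries_three (x : ℝ) (h0 : 0 < x) (h1 : x < 1) :
    iteratedSeries 3 x = x ^ (0 + 1) * (Real.log (2 * x) - 1) + clausenSin 2 x / 2 := by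
  refine iteratedSeries_succ_eq
    (G := fun x => x ^ (0 + 1) * (Real.log (2 * x) - 1) + clausenSin 2 x / 2)
    (fun y => iteratedSeries_two) (fun y hy0 hy1 => ?_)
    ((continuous_pow_mul_log 0 1).add ((continuous_clausenSin one_lt_two).div_const 2))
    (by simp [clausenSin_zero]) x h0 h1
  refine ((hasDerivAt_pow_mul_log 0 1 hy0).add
    ((hasDerivAt_clausenSin_two hy0 hy1).div_const 2)).congr_deriv ?_
  -- The order-two form is rewritten as `log (2y) - log (2 sin y)`, whose second part is half the
  -- derivative of `clausenSin 2`.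
  rw [Real.log_mul two_ne_zero hy0.ne',
    Real.log_mul two_ne_zero (sin_pos_of_lt_one hy0 hy1.le).ne']
  push_cast
  ring

/-- Vanishing at `0` forces the constant `ζ(3) = clausenCos 3 0`; `ζ(5)` and `ζ(7)` enter likewise
at orders 6 and 8. -/
theorem iteratedSeries_four (x : ℝ) (h0 : 0 < x) (h1 : x < 1) :
    iteratedSeries 4 x = x ^ (1 + 1) * (Real.log (2 * x) - 3 / 2) / 2 +
      (zetaReal 3 - clausenCos 3 x) / 4 := by
  refine iteratedSeries_succ_eq
    (G := fun x => x ^ (1 + 1) * (Real.log (2 * x) - 3 / 2) / 2 +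
      (zetaReal 3 - clausenCos 3 x) / 4)
    iteratedSeries_three (fun y hy0 hy1 => ?_)
    (((continuous_pow_mul_log 1 _).div_const _).add
      ((continuous_const.sub (continuous_clausenCos (by norm_num))).div_const _))
    (by simp [clausenCos_zero]) x h0 h1
  refine (((hasDerivAt_pow_mul_log 1 (3 / 2) hy0).div_const 2).add
    (((hasDerivAt_clausenCos one_lt_two y).const_sub (zetaReal 3)).div_const 4)).congr_deriv ?_
  push_cast
  ring

theorem iteratedSeries_five (x : ℝ) (h0 : 0 < x) (h1 : x < 1) :
    iteratedSeries 5 x = x ^ (2 + 1) * (Real.log (2 * x) - 11 / 6) / 6 +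
      (zetaReal 3 * x / 4 - clausenSin 4 x / 8) := by
  refine iteratedSeries_succ_eq
    (G := fun x => x ^ (2 + 1) * (Real.log (2 * x) - 11 / 6) / 6 +
      (zetaReal 3 * x / 4 - clausenSin 4 x / 8))
    iteratedSeries_four (fun y hy0 hy1 => ?_)
    (((continuous_pow_mul_log 2 _).div_const _).add
      (Continuous.sub (by fun_prop) ((continuous_clausenSin (by norm_num)).div_const _)))
    (by simp [clausenSin_zero]) x h0 h1
  refine (((hasDerivAt_pow_mul_log 2 (11 / 6) hy0).div_const 6).add
    ((((hasDerivAt_id y).const_mul (zetaReal 3)).div_const 4).sub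
      ((hasDerivAt_clausenSin (by norm_num : 1 < 3) y).div_const 8))).congr_deriv ?_
  push_cast
  ring

theorem iteratedSeries_six (x : ℝ) (h0 : 0 < x) (h1 : x < 1) :
    iteratedSeries 6 x = x ^ (3 + 1) * (Real.log (2 * x) - 25 / 12) / 24 +
      (zetaReal 3 * x ^ 2 / 8 - (zetaReal 5 - clausenCos 5 x) / 16) := by
  refine iteratedSeries_succ_eq
    (G := fun x => x ^ (3 + 1) * (Real.log (2 * x) - 25 / 12) / 24 +
      (zetaReal 3 * x ^ 2 / 8 - (zetaReal 5 - clausenCos 5 x) / 16))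
    iteratedSeries_five (fun y hy0 hy1 => ?_)
    (((continuous_pow_mul_log 3 _).div_const _).add
      (Continuous.sub (by fun_prop)
        ((continuous_const.sub (continuous_clausenCos (by norm_num))).div_const _)))
    (by simp [clausenCos_zero]) x h0 h1
  refine (((hasDerivAt_pow_mul_log 3 (25 / 12) hy0).div_const 24).add
    ((((hasDerivAt_pow 2 y).const_mul (zetaReal 3)).div_const 8).sub
      (((hasDerivAt_clausenCos (by norm_num : 1 < 4) y).const_sub
        (zetaReal 5)).div_const 16))).congr_deriv ?_
  push_cast
  ring

theorem iteratedSeries_seven (x : ℝ) (h0 : 0 < x) (h1 : x < 1) :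
    iteratedSeries 7 x = x ^ (4 + 1) * (Real.log (2 * x) - 137 / 60) / 120 +
      (zetaReal 3 * x ^ 3 / 24 - zetaReal 5 * x / 16 + clausenSin 6 x / 32) := by
  refine iteratedSeries_succ_eq
    (G := fun x => x ^ (4 + 1) * (Real.log (2 * x) - 137 / 60) / 120 +
      (zetaReal 3 * x ^ 3 / 24 - zetaReal 5 * x / 16 + clausenSin 6 x / 32))
    iteratedSeries_six (fun y hy0 hy1 => ?_)
    (((continuous_pow_mul_log 4 _).div_const _).add
      (Continuous.add (by fun_prop) ((continuous_clausenSin (by norm_num)).div_const _)))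
    (by simp [clausenSin_zero]) x h0 h1
  refine (((hasDerivAt_pow_mul_log 4 (137 / 60) hy0).div_const 120).add
    (((((hasDerivAt_pow 3 y).const_mul (zetaReal 3)).div_const 24).sub
      (((hasDerivAt_id y).const_mul (zetaReal 5)).div_const 16)).add
      ((hasDerivAt_clausenSin (by norm_num : 1 < 5) y).div_const 32))).congr_deriv ?_
  push_cast
  ring

theorem iteratedSeries_eight (x : ℝ) (h0 : 0 < x) (h1 : x < 1) :
    iteratedSeries 8 x = x ^ (5 + 1) * (Real.log (2 * x) - 49 / 20) / 720 +
      (zetaReal 3 * x ^ 4 / 96 - zetaReal 5 * x ^ 2 / 32 +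
        (zetaReal 7 - clausenCos 7 x) / 64) := by
  refine iteratedSeries_succ_eq
    (G := fun x => x ^ (5 + 1) * (Real.log (2 * x) - 49 / 20) / 720 +
      (zetaReal 3 * x ^ 4 / 96 - zetaReal 5 * x ^ 2 / 32 +
        (zetaReal 7 - clausenCos 7 x) / 64))
    iteratedSeries_seven (fun y hy0 hy1 => ?_)
    (((continuous_pow_mul_log 5 _).div_const _).add
      (Continuous.add (by fun_prop)
        ((continuous_const.sub (continuous_clausenCos (by norm_num))).div_const _)))
    (by simp [clausenCos_zero]) x h0 h1
  refine (((hasDerivAt_pow_mul_log 5 (49 / 20) hy0).div_const 720).add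
    (((((hasDerivAt_pow 4 y).const_mul (zetaReal 3)).div_const 96).sub
      (((hasDerivAt_pow 2 y).const_mul (zetaReal 5)).div_const 32)).add
      (((hasDerivAt_clausenCos (by norm_num : 1 < 6) y).const_sub
        (zetaReal 7)).div_const 64))).congr_deriv ?_
  push_cast
  ring

/-! ### Cosine sums at `π/6` and the zeta identities. -/

theorem hasSum_zetaReal_dvd {s d : ℕ} (hs : 1 < s) (hd : 0 < d) :
    HasSum (fun k : ℕ => (if d ∣ k then 1 else 0) / (k : ℝ) ^ s) (zetaReal s / d ^ s) := by
  have h := (Real.summable_one_div_nat_pow.2 hs).hasSum.div_const ((d : ℝ) ^ s)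
  have hinj : Function.Injective (fun k : ℕ => d * k) := fun a b hab =>
    Nat.eq_of_mul_eq_mul_left hd hab
  refine (hinj.hasSum_iff fun k hk => ?_).1 ?_
  · have : ¬ d ∣ k := fun ⟨c, hc⟩ => hk ⟨c, hc.symm⟩
    simp [this]
  · refine h.congr_fun fun k => ?_
    simp only [Function.comp_apply, dvd_mul_right, if_true]
    push_cast
    rw [mul_pow, div_div, mul_comm]

/-- Twice the cosine is the Ramanujan sum `c_6(k) = ∑_{d ∣ gcd(6,k)} μ(6/d) d`; the check runs over
residues mod 6. -/
theorem cos_mul_pi_div_three (k : ℕ) :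
    Real.cos (2 * k * (Real.pi / 6)) = (1 - 2 * (if 2 ∣ k then 1 else 0) -
      3 * (if 3 ∣ k then 1 else 0) + 6 * (if 6 ∣ k then 1 else 0)) / 2 := by
  obtain ⟨q, j, hj, rfl⟩ : ∃ q j, j < 6 ∧ k = 6 * q + j :=
    ⟨k / 6, k % 6, Nat.mod_lt _ (by norm_num), (Nat.div_add_mod k 6).symm⟩
  have e : (2 * ((6 * q + j : ℕ) : ℝ) * (Real.pi / 6)) = j * (Real.pi / 3) + q * (2 * Real.pi) := by
    push_cast
    ring
  have h2 : 2 ∣ 6 * q + j ↔ 2 ∣ j := by omega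
  have h3 : 3 ∣ 6 * q + j ↔ 3 ∣ j := by omega
  have h6 : 6 ∣ 6 * q + j ↔ 6 ∣ j := by omega
  rw [e, Real.cos_add_nat_mul_two_pi]
  simp only [h2, h3, h6]
  interval_cases j
  · norm_num
  · norm_num
  · rw [show ((2 : ℕ) : ℝ) * (Real.pi / 3) = Real.pi - Real.pi / 3 by push_cast; ring,
      Real.cos_pi_sub]
    norm_num
  · rw [show ((3 : ℕ) : ℝ) * (Real.pi / 3) = Real.pi by push_cast; ring]
    norm_num
  · rw [show ((4 : ℕ) : ℝ) * (Real.pi / 3) = Real.pi / 3 + Real.pi by push_cast; ring,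
      Real.cos_add_pi]
    norm_num
  · rw [show ((5 : ℕ) : ℝ) * (Real.pi / 3) = 2 * Real.pi - Real.pi / 3 by push_cast; ring,
      Real.cos_two_pi_sub]
    norm_num

theorem clausenCos_pi_div_six {s : ℕ} (hs : 1 < s) :
    clausenCos s (Real.pi / 6) =
      (1 - 2 / 2 ^ s - 3 / 3 ^ s + 6 / 6 ^ s) / 2 * zetaReal s := by
  have h1 := (Real.summable_one_div_nat_pow.2 hs).hasSum
  have h2 := (hasSum_zetaReal_dvd hs (by norm_num : 0 < 2)).mul_left 2
  have h3 := (hasSum_zetaReal_dvd hs (by norm_num : 0 < 3)).mul_left 3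
  have h6 := (hasSum_zetaReal_dvd hs (by norm_num : 0 < 6)).mul_left 6
  have h := ((((h1.sub h2).sub h3).add h6).div_const 2).tsum_eq
  rw [← zetaReal] at h
  push_cast at h
  rw [clausenCos]
  trans (zetaReal s - 2 * (zetaReal s / 2 ^ s) - 3 * (zetaReal s / 3 ^ s)
    + 6 * (zetaReal s / 6 ^ s)) / 2
  · rw [← h]
    refine tsum_congr fun k => ?_
    rw [cos_mul_pi_div_three]
    ring
  · ring

/-- At `s = 5` the cosine sum is `25/54 · ζ(5)`, so `ζ(5)` survives with factor `29/54`, the source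
of the `29`. -/
theorem zetaReal_five_eq :
    zetaReal 5 = 3 * Real.pi ^ 2 / 29 * zetaReal 3 - 25 * Real.pi ^ 4 / 12528
      + Real.pi ^ 4 / 1044 * Real.log (Real.pi / 3)
      - 144 * Real.pi ^ 2 / 29 * ∑' l : ℕ, outerTerm 6 (l + 1) := by
  have hpi := Real.pi_pos
  rw [(hasSum_outerTerm 6).tsum_eq,
    iteratedSeries_six (Real.pi / 6) (by positivity) (by linarith [Real.pi_lt_four]),
    clausenCos_pi_div_six (by norm_num), show 2 * (Real.pi / 6) = Real.pi / 3 by ring]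
  field_simp
  ring

/-- Here the surviving factor of `ζ(7)` is `659/1296`. -/
theorem zetaReal_seven_eq :
    zetaReal 7 = 72 * Real.pi ^ 2 / 659 * zetaReal 5 - 2 * Real.pi ^ 4 / 1977 * zetaReal 3
      + 49 * Real.pi ^ 6 / 5337900 - Real.pi ^ 6 / 266895 * Real.log (Real.pi / 3)
      + 3456 * Real.pi ^ 4 / 5931 * ∑' l : ℕ, outerTerm 8 (l + 1) := by
  have hpi := Real.pi_pos
  rw [(hasSum_outerTerm 8).tsum_eq,
    iteratedSeries_eight (Real.pi / 6) (by positivity) (by linarith [Real.pi_lt_four]),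
    clausenCos_pi_div_six (by norm_num), show 2 * (Real.pi / 6) = Real.pi / 3 by ring]
  field_simp
  ring

theorem riemannZeta_odd :
    riemannZeta 3 = (zetaReal 3 : ℂ) ∧ riemannZeta 5 = (zetaReal 5 : ℂ) ∧
      riemannZeta 7 = (zetaReal 7 : ℂ) :=
  ⟨mod_cast riemannZeta_eq_zetaReal (s := 3) (by norm_num),
    mod_cast riemannZeta_eq_zetaReal (s := 5) (by norm_num),
    mod_cast riemannZeta_eq_zetaReal (s := 7) (by norm_num)⟩

end OddZeta

theorem mainTheorem12 :
    ((∀ l : ℕ, 1 ≤ l → Summable (fun n : ℕ => OddZeta.coeffTerm 6 l (n + 1))) ∧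
      Summable (fun l : ℕ => OddZeta.outerTerm 6 (l + 1)) ∧
      riemannZeta 5 =
        3 * (Real.pi : ℂ) ^ 2 / 29 * riemannZeta 3
          - 25 * (Real.pi : ℂ) ^ 4 / 12528
          + (Real.pi : ℂ) ^ 4 / 1044 * (Real.log (Real.pi / 3) : ℂ)
          - 144 * (Real.pi : ℂ) ^ 2 / 29 * ((∑' l : ℕ, OddZeta.outerTerm 6 (l + 1) : ℝ) : ℂ)) ∧
    ((∀ l : ℕ, 1 ≤ l → Summable (fun n : ℕ => OddZeta.coeffTerm 8 l (n + 1))) ∧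
      Summable (fun l : ℕ => OddZeta.outerTerm 8 (l + 1)) ∧
      riemannZeta 7 =
        72 * (Real.pi : ℂ) ^ 2 / 659 * riemannZeta 5
          - 2 * (Real.pi : ℂ) ^ 4 / 1977 * riemannZeta 3
          + 49 * (Real.pi : ℂ) ^ 6 / 5337900
          - (Real.pi : ℂ) ^ 6 / 266895 * (Real.log (Real.pi / 3) : ℂ)
          + 3456 * (Real.pi : ℂ) ^ 4 / 5931
            * ((∑' l : ℕ, OddZeta.outerTerm 8 (l + 1) : ℝ) : ℂ)) := by
  obtain ⟨h3, h5, h7⟩ := OddZeta.riemannZeta_odd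
  rw [h3, h5, h7]
  refine ⟨⟨OddZeta.summable_coeffTerm 6, (OddZeta.hasSum_outerTerm 6).summable, ?_⟩,
    OddZeta.summable_coeffTerm 8, (OddZeta.hasSum_outerTerm 8).summable, ?_⟩
  · exact_mod_cast congrArg (Complex.ofReal) OddZeta.zetaReal_five_eq
  · exact_mod_cast congrArg (Complex.ofReal) OddZeta.zetaReal_seven_eq
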